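/- **Theorem (contraction of piecewise smooth continuous systems).** Let $|\cdot|$ be any norm on $\mathbb R^n$, with induced matrix norm $\|\cdot\|$ and associated matrix measure $\mu(A)=\lim_{h\searrow 0}\frac1h(\|I+hA\|-1)$, and let $t_0\in\mathbb R$. Let $\mathcal S_1,\dots,\mathcal S_p\subseteq\mathbb R^n$ be pairwise disjoint, nonempty open sets such that $\mathcal D=\bigcup_i\overline{\mathcal S_i}$ is connected. Let $f$ be continuous on $\mathcal D\times[t_0,\infty)$ with values in $\mathbb R^n$, and suppose $f(x,t)=F_i(x,t)$ for $x\in\mathcal S_i$, $t\ge t_0$, where each mode $F_i$ is defined on $U_i\times[t_0,\infty)$ for an open set $U_i\supseteq\overline{\mathcal S_i}$, is continuous there and differentiable in $x$, and $\partial F_i/\partial x$ is continuous on $U_i\times[t_0,\infty)$. (The interfaces $\overline{\mathcal S_i}\cap\overline{\mathcal S_j}$, $i\ne j$, may be arbitrary; in particular they may be lower-dimensional smooth manifolds.) A *Caratheodory solution* of $\dot x=f(x,t)$ on $[t_0,t_1]$ is an absolutely continuous $x:[t_0,t_1]\to\mathcal D$ that satisfies the equation for almost every $t$. Suppose that $f$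 satisfies the Caratheodory conditions for existence and uniqueness: 1. for almost every $t\ge t_0$, $x\mapsto f(x,t)$ is continuous on $\mathcal D$; 2. for every $x\in\mathcal D$, $t\mapsto f(x,t)$ is measurable; 3. for every $x\in\mathcal D$ and $t\ge t_0$ there are $\delta>0$ and an integrable $m$ on $[t,t+\delta]$ with $|f(x,s)|\le m(s)$ for $s\in[t,t+\delta]$; 4. there is a function $l$, integrable on bounded subintervals of $[t_0,\infty)$, with $(x-y)^T(f(x,t)-f(y,t))\le l(t)\,(x-y)^T(x-y)$ for all $x,y\in\mathcal D$, $t\ge t_0$. Let $K>0$ and let $\mathcal C\subseteq\mathcal D$ be $K$-reachable: any $x_0,y_0\in\mathcal C$ are joined by a $C^1$ curve $\gamma:[0,1]\to\mathcal C$ with $\gamma(0)=x_0$, $\gamma(1)=y_0$ and $|\gamma'(r)|\le K|y_0-x_0|$ for all $r$. Suppose that there are $c_1,\dots,c_p>0$ with $$\mu\Big(\frac{\partial F_i}{\partial x}(x,t)\Big)\le -c_i\qquad\text{for all } x\in\overline{\mathcal S_i},\ t\ge t_0,\ i=1,\dots,p,$$ and put $c=\min_i c_i$. * Let $t_1\ge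 t_0$ be such that the flow from $\mathcal C$ is defined up to time $t_1$, i.e. from every point of $\mathcal C$ at time $t_0$ there starts a Caratheodory solution on $[t_0,t_1]$. Then any two Caratheodory solutions $x,y$ on $[t_0,t_1]$ with $x(t_0)=\xi\in\mathcal C$ and $y(t_0)=\zeta\in\mathcal C$ satisfy $$|x(t)-y(t)|\le K e^{-c(t-t_0)}|\xi-\zeta|$$ for all $t\in[t_0,t_1]$ with $x(t),y(t)\in\mathcal C$. * If $\mathcal C$ is forward invariant (from every point of $\mathcal C$ at time $t_0$ there start Caratheodory solutions on every $[t_0,t_1]$, $t_1\ge t_0$, and all solutions starting in $\mathcal C$ at time $t_0$ remain in $\mathcal C$), then any two solutions on $[t_0,\infty)$ that start in $\mathcal C$ satisfy this estimate for all $t\ge t_0$; in particular $|x(t)-y(t)|\to0$ exponentially as $t\to\infty$. -/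

import Mathlib

open Set Filter Topology MeasureTheory

/-- Column vectors of `ℝⁿ`; the standard (Euclidean) structure is used only for the topology,
derivatives, measure and the scalar product `xᵀy`. The norm `|·|` of the theory is arbitrary. -/
abbrev Vec (n : ℕ) : Type := EuclideanSpace ℝ (Fin n)

/-- A vector norm `|·|` on `ℝⁿ`: a seminorm that vanishes only at `0`. -/
def IsVectorNorm {n : ℕ} (N : Seminorm ℝ (Vec n)) : Prop :=
  ∀ x, N x = 0 → x = 0

/-- The matrix (operator) norm `‖A‖` induced by the vector norm `N`:
the least `M ≥ 0` with `|A x| ≤ M |x|` for all `x`. -/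
noncomputable def inducedNorm {n : ℕ} (N : Seminorm ℝ (Vec n)) (A : Vec n →L[ℝ] Vec n) : ℝ :=
  sInf {M : ℝ | 0 ≤ M ∧ ∀ x, N (A x) ≤ M * N x}

/-- The matrix measure (logarithmic norm) associated with the vector norm `N`:
`μ(A) = lim_{h ↘ 0} (‖I + h A‖ - 1) / h`. -/
noncomputable def matrixMeasure {n : ℕ} (N : Seminorm ℝ (Vec n)) (A : Vec n →L[ℝ] Vec n) : ℝ :=
  limUnder (𝓝[>] (0 : ℝ))
    (fun h : ℝ => (inducedNorm N (ContinuousLinearMap.id ℝ (Vec n) + h • A) - 1) / h)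

/-- `C` is `K`-reachable with respect to the norm `N`: any two points of `C` are joined by a `C¹`
curve inside `C` whose speed is at most `K` times the distance of the two points. -/
def IsKReachable {n : ℕ} (N : Seminorm ℝ (Vec n)) (K : ℝ) (C : Set (Vec n)) : Prop :=
  0 < K ∧ ∀ x₀ ∈ C, ∀ y₀ ∈ C, ∃ γ : ℝ → Vec n,
    ContDiffOn ℝ 1 γ (Icc 0 1) ∧ (∀ r ∈ Icc (0 : ℝ) 1, γ r ∈ C) ∧ γ 0 = x₀ ∧ γ 1 = y₀ ∧
      ∀ r ∈ Icc (0 : ℝ) 1, N (derivWithin γ (Icc 0 1) r) ≤ K * N (y₀ - x₀)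

/-- `x` is a Caratheodory solution on `[t₀, t₁]`, with values in `D`, of `x' = f(x, t)`. -/
structure IsCaratheodorySolution {n : ℕ} (f : Vec n → ℝ → Vec n) (D : Set (Vec n))
    (t₀ t₁ : ℝ) (x : ℝ → Vec n) : Prop where
  mem : ∀ t ∈ Icc t₀ t₁, x t ∈ D
  absolutelyContinuous : AbsolutelyContinuousOnInterval x t₀ t₁
  ode : ∀ᵐ t ∂(volume.restrict (Icc t₀ t₁)), HasDerivAt x (f (x t) t) t

/-- The Caratheodory conditions for existence (first three fields) and for uniqueness (last field)
of solutions, for the vector field `f` on the domain `D` and for times `t ≥ t₀`. -/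
structure CaratheodoryConditions {n : ℕ} (N : Seminorm ℝ (Vec n)) (f : Vec n → ℝ → Vec n)
    (D : Set (Vec n)) (t₀ : ℝ) : Prop where
  continuous_state : ∀ᵐ t ∂(volume.restrict (Ici t₀)), ContinuousOn (fun x => f x t) D
  measurable_time : ∀ x ∈ D, AEStronglyMeasurable (fun t => f x t) (volume.restrict (Ici t₀))
  locally_dominated : ∀ x ∈ D, ∀ t, t₀ ≤ t → ∃ δ : ℝ, 0 < δ ∧ ∃ m : ℝ → ℝ,
    IntegrableOn m (Icc t (t + δ)) ∧ ∀ s ∈ Icc t (t + δ), N (f x s) ≤ m s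
  one_sided_lipschitz : ∃ l : ℝ → ℝ, (∀ T, t₀ ≤ T → IntegrableOn l (Icc t₀ T)) ∧
    ∀ t, t₀ ≤ t → ∀ x ∈ D, ∀ y ∈ D,
      inner ℝ (x - y) (f x t - f y t) ≤ l t * inner ℝ (x - y) (x - y)

/-- `x' = f(x, t)` is a piecewise smooth continuous (PWSC) system on `D` with modes
`F 0, …, F (p - 1)` on the regions `S 0, …, S (p - 1)`, for times `t ≥ t₀`.
Smoothness of the mode `F i` up to the boundary of its region is understood in the usual sense for
non-open sets: `F i` is defined on an open set containing the closure of `S i`, is jointly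
continuous there, and is `C¹` in the state with Jacobian jointly continuous there.
Neither further smoothness of the modes nor regularity of the interfaces
`closure (S i) ∩ closure (S j)` is imposed. -/
structure IsPWSC {n p : ℕ} (S : Fin p → Set (Vec n)) (F : Fin p → Vec n → ℝ → Vec n)
    (f : Vec n → ℝ → Vec n) (D : Set (Vec n)) (t₀ : ℝ) : Prop where
  isOpen : ∀ i, IsOpen (S i)
  nonempty : ∀ i, (S i).Nonempty
  disjoint : ∀ i j, i ≠ j → Disjoint (S i) (S j)
  domain : D = ⋃ i, closure (S i)
  connected : IsConnected D
  eq_mode : ∀ i, ∀ x ∈ S i, ∀ t, t₀ ≤ t → f x t = F i x t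
  continuous : ContinuousOn (fun q : Vec n × ℝ => f q.1 q.2) (D ×ˢ Ici t₀)
  mode_smooth : ∀ i, ∃ U : Set (Vec n), IsOpen U ∧ closure (S i) ⊆ U ∧
    ContinuousOn (fun q : Vec n × ℝ => F i q.1 q.2) (U ×ˢ Ici t₀) ∧
    (∀ t, t₀ ≤ t → DifferentiableOn ℝ (fun x => F i x t) U) ∧
    ContinuousOn (fun q : Vec n × ℝ => fderiv ℝ (fun x => F i x q.2) q.1) (U ×ˢ Ici t₀)

/-- The flow of `x' = f(x, t)` from time `t₀` is defined on `C` up to time `t₁`: from every point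
of `C` there starts a Caratheodory solution on `[t₀, t₁]`. -/
def FlowDefined {n : ℕ} (f : Vec n → ℝ → Vec n) (D C : Set (Vec n)) (t₀ t₁ : ℝ) : Prop :=
  ∀ χ ∈ C, ∃ z : ℝ → Vec n, IsCaratheodorySolution f D t₀ t₁ z ∧ z t₀ = χ

/-- `C` is forward invariant from time `t₀`: the flow from `C` is defined for all `t ≥ t₀` and all
solutions that start in `C` remain in `C`. -/
def IsForwardInvariantSet {n : ℕ} (f : Vec n → ℝ → Vec n) (D C : Set (Vec n)) (t₀ : ℝ) : Prop :=
  ∀ t₁, t₀ ≤ t₁ → FlowDefined f D C t₀ t₁ ∧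
    ∀ z : ℝ → Vec n, IsCaratheodorySolution f D t₀ t₁ z → z t₀ ∈ C → ∀ t ∈ Icc t₀ t₁, z t ∈ C

/-!
The curve `γ` in `C` that joins the two initial values is transported by the flow: `Ψ t r` is the
value at time `t` of the solution that starts at `γ r`. It suffices to show that the tangent vector
`∂Ψ/∂r` decays like `exp (-c (t - t₀))` in the norm `N`; integrating along the curve then bounds the
distance of its end points, which are the two given solutions. The vector field is only continuous
across the interfaces, and the domain need not contain the segments between nearby points of `Ψ t`,
so the flow cannot be differentiated by the classical theory. Three facts replace it.

* The one-sided Lipschitz condition makes `Ψ t` a Lipschitz curve, uniformly in `t`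
  (`CaratheodoryConditions.exists_norm_sub_le`). This also gives uniqueness.
* Along a curve in `D`, the velocity `G t = f (Ψ t ·) t` is a continuous selection of finitely many
  locally Lipschitz functions, hence Lipschitz (`LipschitzWith.of_finite_closed_cover`); and since
  each parameter `r` is a limit of parameters at which one fixed mode is active, a derivative of
  `G t` at `r` is the Jacobian of that mode applied to the derivative of `Ψ t`
  (`IsPWSC.exists_fderiv_mode_eq`). No regularity of the interfaces is used.
* By the theorems of Rademacher and Fubini, for almost every `r` the curve `G t` is differentiable
  at `r` for almost every `t`. Differentiating the integral equation for `Ψ` under the integral sign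
  shows that for such `r` the tangent vector `W t` exists for all `t`, is Lipschitz in `t`, and
  satisfies `W' = A W` almost everywhere with matrices `A` of measure at most `-c`. Then
  `(N W)' ≤ -c N W` almost everywhere (`IsVectorNorm.deriv_le_of_matrixMeasure_le`), and
  Grönwall's inequality for absolutely continuous functions gives the decay
  (`IsVectorNorm.map_sub_le_of_contracting_family`).
-/

/-! ### Absolutely continuous functions -/

lemma LipschitzOnWith.comp_absolutelyContinuousOnInterval {X Y : Type*} [PseudoMetricSpace X]
    [PseudoMetricSpace Y] {M : NNReal} {g : X → Y} {f : ℝ → X} {a b : ℝ} {s : Set X}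
    (hg : LipschitzOnWith M g s) (hf : AbsolutelyContinuousOnInterval f a b)
    (hs : MapsTo f (uIcc a b) s) :
    AbsolutelyContinuousOnInterval (fun t => g (f t)) a b := by
  rw [absolutelyContinuousOnInterval_iff] at hf ⊢
  intro ε hε
  obtain ⟨δ, hδ, H⟩ := hf (ε / (M + 1)) (by positivity)
  refine ⟨δ, hδ, fun E hE hlt => ?_⟩
  have h1 := H E hE hlt
  calc ∑ i ∈ Finset.range E.1, dist (g (f (E.2 i).1)) (g (f (E.2 i).2))
      ≤ ∑ i ∈ Finset.range E.1, M * dist (f (E.2 i).1) (f (E.2 i).2) :=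
        Finset.sum_le_sum fun i hi =>
          hg.dist_le_mul _ (hs (hE.1 i hi).1) _ (hs (hE.1 i hi).2)
    _ = M * ∑ i ∈ Finset.range E.1, dist (f (E.2 i).1) (f (E.2 i).2) := by
        rw [Finset.mul_sum]
    _ ≤ (M + 1) * ∑ i ∈ Finset.range E.1, dist (f (E.2 i).1) (f (E.2 i).2) := by
        gcongr
        linarith
    _ < (M + 1) * (ε / (M + 1)) := by gcongr
    _ = ε := by field_simp

lemma AbsolutelyContinuousOnInterval.le_add_integral_of_ae_deriv_le {u v : ℝ → ℝ} {a b : ℝ}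
    (hab : a ≤ b) (hu : AbsolutelyContinuousOnInterval u a b) (hv : IntervalIntegrable v volume a b)
    (h : ∀ᵐ t, t ∈ Ioo a b → deriv u t ≤ v t) : u b ≤ u a + ∫ t in a..b, v t := by
  have h1 := hu.integral_deriv_eq_sub
  have h2 : ∫ t in a..b, deriv u t ≤ ∫ t in a..b, v t := by
    refine intervalIntegral.integral_mono_ae_restrict hab hu.intervalIntegrable_deriv hv ?_
    rw [Filter.EventuallyLE, ← restrict_Ioo_eq_restrict_Icc, ae_restrict_iff' measurableSet_Ioo]
    exact h
  linarith

/-- Grönwall's inequality for absolutely continuous functions with an integrable rate; the sign of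
`u` is irrelevant. -/
lemma AbsolutelyContinuousOnInterval.le_exp_integral_mul {u l : ℝ → ℝ} {a b : ℝ}
    (hab : a ≤ b) (hu : AbsolutelyContinuousOnInterval u a b) (hl : IntervalIntegrable l volume a b)
    (h : ∀ᵐ t, t ∈ Ioo a b → deriv u t ≤ l t * u t) :
    u b ≤ Real.exp (∫ t in a..b, l t) * u a := by
  set Λ : ℝ → ℝ := fun t => ∫ s in a..t, l s with hΛ
  have hΛac : AbsolutelyContinuousOnInterval Λ a b :=
    hl.absolutelyContinuousOnInterval_intervalIntegral (c := a) (by simp)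
  obtain ⟨R, hR⟩ := hΛac.exists_bound
  have hexp : ContDiffOn ℝ 1 (fun x : ℝ => Real.exp (-x)) (Icc (-R) R) :=
    (Real.contDiff_exp.comp contDiff_neg).contDiffOn
  obtain ⟨M, hM⟩ := hexp.exists_lipschitzOnWith (by decide) (convex_Icc _ _) isCompact_Icc
  have hE : AbsolutelyContinuousOnInterval (fun t => Real.exp (-Λ t)) a b :=
    hM.comp_absolutelyContinuousOnInterval hΛac fun t ht => abs_le.1 (hR t ht)
  -- `exp (-Λ) * u` is absolutely continuous with nonpositive derivative.
  have hprod := hE.fun_mul hu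
  have key := hprod.le_add_integral_of_ae_deriv_le hab (v := fun _ => 0) (by simp) (by
    filter_upwards [h, hu.ae_differentiableAt, hl.ae_hasDerivAt_integral] with t h1 h2 h3 ht
    have ht' : t ∈ uIcc a b := by rw [uIcc_of_le hab]; exact Ioo_subset_Icc_self ht
    have d1 : HasDerivAt (fun t => Real.exp (-Λ t)) (Real.exp (-Λ t) * (-l t)) t :=
      (h3 ht' a (by simp)).neg.exp
    have d2 := (d1.mul (h2 ht').hasDerivAt).deriv
    have d3 : deriv (fun t => Real.exp (-Λ t) * u t) t =
      Real.exp (-Λ t) * (-l t) * u t + Real.exp (-Λ t) * deriv u t := d2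
    rw [d3]
    nlinarith [h1 ht, Real.exp_pos (-Λ t)])
  simp only [intervalIntegral.integral_zero, add_zero] at key
  have e0 : Λ a = 0 := by simp [hΛ]
  rw [e0, neg_zero, Real.exp_zero, one_mul] at key
  calc u b = Real.exp (Λ b) * (Real.exp (-Λ b) * u b) := by
        rw [← mul_assoc, ← Real.exp_add]; simp
    _ ≤ Real.exp (Λ b) * u a := by gcongr

lemma lipschitzOnWith_intervalIntegral {E : Type*} [NormedAddCommGroup E] [NormedSpace ℝ E]
    {v : ℝ → E} {a b : ℝ} {R : NNReal} (hab : a ≤ b) (hv : IntervalIntegrable v volume a b)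
    (hR : ∀ t ∈ Icc a b, ‖v t‖ ≤ R) :
    LipschitzOnWith R (fun t => ∫ s in a..t, v s) (uIcc a b) := by
  rw [uIcc_of_le hab]
  have hint : ∀ t ∈ Icc a b, IntervalIntegrable v volume a t := fun t ht =>
    hv.mono_set (by rw [uIcc_of_le hab, uIcc_of_le ht.1]; exact Icc_subset_Icc_right ht.2)
  refine LipschitzOnWith.of_dist_le_mul fun t ht s hs => ?_
  rw [dist_eq_norm, intervalIntegral.integral_interval_sub_left (hint t ht) (hint s hs),
    Real.dist_eq]
  refine intervalIntegral.norm_integral_le_of_norm_le_const fun r hr => hR r ?_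
  have := uIoc_subset_uIcc hr
  exact (uIcc_subset_Icc hs ht) this

lemma AbsolutelyContinuousOnInterval.eq_add_integral_of_ae_hasDerivAt {E : Type*}
    [NormedAddCommGroup E] [NormedSpace ℝ E] [CompleteSpace E] {x v : ℝ → E} {a b : ℝ}
    (hab : a ≤ b) (hx : AbsolutelyContinuousOnInterval x a b) (hv : ContinuousOn v (Icc a b))
    (h : ∀ᵐ t, t ∈ Icc a b → HasDerivAt x (v t) t) {t : ℝ} (ht : t ∈ Icc a b) :
    x t = x a + ∫ s in a..t, v s := by
  have hvi : IntervalIntegrable v volume a b := hv.intervalIntegrable_of_Icc hab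
  obtain ⟨R, hR⟩ := isCompact_Icc.exists_bound_of_continuousOn hv
  have hI : AbsolutelyContinuousOnInterval (fun t => ∫ s in a..t, v s) a b :=
    (lipschitzOnWith_intervalIntegral (R := R.toNNReal) hab hvi fun t ht =>
      (hR t ht).trans (Real.le_coe_toNNReal R)).absolutelyContinuousOnInterval
  obtain ⟨C, hC⟩ := (hx.fun_sub hI).const_of_ae_hasDerivAt_zero (by
    filter_upwards [h, hvi.ae_hasDerivAt_integral] with t h1 h2 ht
    have d1 := h1 (by rwa [uIcc_of_le hab] at ht)
    have d2 := d1.sub (h2 ht a left_mem_uIcc)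
    rw [sub_self] at d2
    exact d2)
  have h1 := hC t (by rwa [uIcc_of_le hab])
  have h2 := hC a (by simp)
  simp only [intervalIntegral.integral_same, sub_zero] at h1 h2
  rw [h2, ← h1]; abel

/-! ### Seminorms along differentiable curves -/

section Seminorm

variable {E : Type*} [NormedAddCommGroup E] [NormedSpace ℝ E]

lemma Seminorm.exists_lipschitzWith [FiniteDimensional ℝ E] (N : Seminorm ℝ E) :
    ∃ M : NNReal, LipschitzWith M N := by
  have hc : Continuous N := by
    rw [← continuousOn_univ]
    exact N.convexOn.continuousOn isOpen_univ
  obtain ⟨M, hM, h⟩ := Seminorm.bound_of_continuous_normedSpace N hc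
  refine ⟨⟨M, hM.le⟩, LipschitzWith.of_dist_le_mul fun x y => ?_⟩
  rw [Real.dist_eq, dist_eq_norm]
  exact (abs_sub_map_le_sub N x y).trans (h _)

/-- At a point where a curve and its image under a seminorm are both differentiable, the curve may
be replaced by its tangent line when differentiating the seminorm. -/
lemma HasDerivAt.tendsto_seminorm_slope {N : Seminorm ℝ E} {M : NNReal} (hM : LipschitzWith M N)
    {W : ℝ → E} {u : E} {d t : ℝ} (hW : HasDerivAt W u t)
    (hd : HasDerivAt (fun s => N (W s)) d t) :
    Tendsto (fun h => (N (W t + h • u) - N (W t)) / h) (𝓝[>] (0 : ℝ)) (𝓝 d) := by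
  rw [hasDerivAt_iff_tendsto_slope_zero] at hW hd
  have h1 : Tendsto (fun h : ℝ => h⁻¹ • (N (W (t + h)) - N (W t))) (𝓝[>] 0) (𝓝 d) :=
    hd.mono_left (nhdsWithin_mono _ fun x hx => (ne_of_gt hx : x ≠ 0))
  have h2 : Tendsto (fun h : ℝ => h⁻¹ • (W (t + h) - W t)) (𝓝[>] 0) (𝓝 u) :=
    hW.mono_left (nhdsWithin_mono _ fun x hx => (ne_of_gt hx : x ≠ 0))
  have h3 : Tendsto (fun h : ℝ => M * ‖h⁻¹ • (W (t + h) - W t) - u‖) (𝓝[>] 0) (𝓝 0) := by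
    have := ((h2.sub_const u).norm).const_mul (M : ℝ)
    simpa using this
  have h4 : Tendsto (fun h : ℝ => (N (W t + h • u) - N (W t)) / h -
      h⁻¹ • (N (W (t + h)) - N (W t))) (𝓝[>] 0) (𝓝 0) := by
    refine squeeze_zero_norm' ?_ h3
    filter_upwards [self_mem_nhdsWithin] with h hh
    have hh : 0 < h := hh
    have e1 : (N (W t + h • u) - N (W t)) / h - h⁻¹ • (N (W (t + h)) - N (W t)) =
        h⁻¹ * (N (W t + h • u) - N (W (t + h))) := by
      rw [smul_eq_mul]; field_simp; ring
    have e2 := hM.dist_le_mul (W t + h • u) (W (t + h))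
    rw [Real.dist_eq, dist_eq_norm] at e2
    have e3 : h⁻¹ • (W (t + h) - W t) - u = -(h⁻¹ • (W t + h • u - W (t + h))) := by
      rw [smul_sub, smul_sub, smul_add, smul_smul, inv_mul_cancel₀ hh.ne', one_smul]; abel
    rw [e1, e3, norm_neg, norm_smul, norm_mul, Real.norm_eq_abs (N _ - _)]
    calc ‖h⁻¹‖ * |N (W t + h • u) - N (W (t + h))|
        ≤ ‖h⁻¹‖ * (M * ‖W t + h • u - W (t + h)‖) := by gcongr
      _ = _ := by ring
  have := h4.add h1
  simpa using this

/-- The chord of a Lipschitz curve is bounded by the speed along it. -/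
lemma Seminorm.map_sub_le_of_ae_deriv_le [FiniteDimensional ℝ E] (N : Seminorm ℝ E) {L : NNReal}
    {q : ℝ → E} (hq : LipschitzWith L q) {B : ℝ}
    (h : ∀ᵐ r, r ∈ Ioo (0 : ℝ) 1 → N (deriv q r) ≤ B) : N (q 1 - q 0) ≤ B := by
  obtain ⟨M, hM⟩ := N.exists_lipschitzWith
  have hq' : LipschitzWith L fun r => q r - q 0 := by
    refine LipschitzWith.of_dist_le_mul fun x y => ?_
    rw [dist_sub_right]; exact hq.dist_le_mul x y
  have hφ : LipschitzWith (M * L) fun r => N (q r - q 0) := hM.comp hq'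
  have key := AbsolutelyContinuousOnInterval.le_add_integral_of_ae_deriv_le
    (u := fun r => N (q r - q 0)) (v := fun _ => B) zero_le_one
    (hφ.lipschitzOnWith.absolutelyContinuousOnInterval) (by simp) (by
      filter_upwards [h, hq.ae_differentiableAt_real, hφ.ae_differentiableAt_real]
        with r h1 h2 h3 hr
      have d1 := h2.hasDerivAt.sub_const (q 0)
      have d2 := d1.tendsto_seminorm_slope hM h3.hasDerivAt
      refine le_of_tendsto d2 ?_
      filter_upwards [self_mem_nhdsWithin] with k hk
      have hk : 0 < k := hk
      rw [div_le_iff₀ hk, sub_le_iff_le_add']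
      refine (map_add_le_add N _ _).trans ?_
      rw [map_smul_eq_mul, Real.norm_of_nonneg hk.le, mul_comm]
      have := h1 hr
      gcongr)
  simpa using key

end Seminorm

/-! ### The induced norm and the matrix measure -/

section MatrixMeasure

variable {n : ℕ} {N : Seminorm ℝ (Vec n)}

/-- Half of the equivalence of norms in finite dimension; it makes the set defining `inducedNorm`
nonempty. -/
lemma IsVectorNorm.exists_norm_le (hN : IsVectorNorm N) : ∃ m : ℝ, 0 ≤ m ∧ ∀ x, ‖x‖ ≤ m * N x := by
  obtain ⟨M, hM⟩ := N.exists_lipschitzWith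
  rcases (Metric.sphere (0 : Vec n) 1).eq_empty_or_nonempty with h0 | hne
  · refine ⟨0, le_rfl, fun x => ?_⟩
    by_contra hx
    have hx : x ≠ 0 := by rintro rfl; simp at hx
    have : (‖x‖⁻¹ • x) ∈ Metric.sphere (0 : Vec n) 1 := by
      simp [norm_smul, hx]
    rw [h0] at this; exact this
  · obtain ⟨z, hz, hmin⟩ := (isCompact_sphere (0 : Vec n) 1).exists_isMinOn hne
      hM.continuous.continuousOn
    have hz0 : z ≠ 0 := by rintro rfl; simp at hz
    have hNz : 0 < N z := lt_of_le_of_ne (apply_nonneg N z) fun h => hz0 (hN z h.symm)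
    refine ⟨(N z)⁻¹, by positivity, fun x => ?_⟩
    by_cases hx : x = 0
    · simp [hx]
    have hx' : 0 < ‖x‖ := norm_pos_iff.2 hx
    have h1 : N z ≤ N (‖x‖⁻¹ • x) := hmin (by simp [norm_smul, hx])
    rw [map_smul_eq_mul, norm_inv, norm_norm] at h1
    field_simp
    field_simp at h1
    linarith

variable (hN : IsVectorNorm N)
include hN

lemma IsVectorNorm.le_inducedNorm_mul (A : Vec n →L[ℝ] Vec n) (x : Vec n) :
    N (A x) ≤ inducedNorm N A * N x := by
  obtain ⟨M, hM⟩ := N.exists_lipschitzWith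
  obtain ⟨m, hm, hle⟩ := hN.exists_norm_le
  have hne : {M : ℝ | 0 ≤ M ∧ ∀ x, N (A x) ≤ M * N x}.Nonempty := by
    refine ⟨M * (‖A‖ * m), by positivity, fun x => ?_⟩
    have h1 := hM.dist_le_mul (A x) 0
    rw [map_zero, dist_zero_right, dist_zero_right, Real.norm_of_nonneg (apply_nonneg N _)] at h1
    calc N (A x) ≤ M * ‖A x‖ := h1
      _ ≤ M * (‖A‖ * (m * N x)) := by
        gcongr
        exact (A.le_opNorm x).trans (by gcongr; exact hle x)
      _ = _ := by ring
  rcases (apply_nonneg N x).eq_or_lt with h0 | hpos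
  · have hx : x = 0 := hN x h0.symm
    simp [hx]
  · rw [← div_le_iff₀ hpos]
    refine le_csInf hne fun b hb => ?_
    rw [div_le_iff₀ hpos]
    exact hb.2 x

omit hN in
lemma inducedNorm_le {A : Vec n →L[ℝ] Vec n} {b : ℝ} (hb : 0 ≤ b) (h : ∀ x, N (A x) ≤ b * N x) :
    inducedNorm N A ≤ b :=
  csInf_le ⟨0, fun _ h => h.1⟩ ⟨hb, h⟩

omit hN in
lemma inducedNorm_nonneg (A : Vec n →L[ℝ] Vec n) : 0 ≤ inducedNorm N A :=
  Real.sInf_nonneg fun _ h => h.1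

/-- The limit defining the matrix measure exists when `n ≠ 0`: the difference quotient is monotone
in `h`, by convexity, and bounded below by `-‖A‖`. -/
lemma IsVectorNorm.tendsto_matrixMeasure {v : Vec n} (hv : v ≠ 0) (A : Vec n →L[ℝ] Vec n) :
    Tendsto (fun h : ℝ => (inducedNorm N (ContinuousLinearMap.id ℝ (Vec n) + h • A) - 1) / h)
      (𝓝[>] 0) (𝓝 (matrixMeasure N A)) := by
  refine tendsto_nhds_limUnder ⟨_, MonotoneOn.tendsto_nhdsGT (x := (0 : ℝ)) ?_ ?_⟩
  · intro h hh k hk hhk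
    have hh : 0 < h := hh
    have hk : 0 < k := hk
    have hq : h / k ≤ 1 := (div_le_one hk).2 hhk
    have h1 : inducedNorm N (ContinuousLinearMap.id ℝ (Vec n) + h • A) ≤
        (1 - h / k) + h / k * inducedNorm N (ContinuousLinearMap.id ℝ (Vec n) + k • A) := by
      refine inducedNorm_le ?_ fun x => ?_
      · have := inducedNorm_nonneg (N := N) (ContinuousLinearMap.id ℝ (Vec n) + k • A)
        have : 0 ≤ 1 - h / k := by linarith
        positivity
      · have e : (ContinuousLinearMap.id ℝ (Vec n) + h • A) x = (1 - h / k) • x +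
            (h / k) • (ContinuousLinearMap.id ℝ (Vec n) + k • A) x := by
          simp only [add_apply, ContinuousLinearMap.id_apply,
            smul_apply, smul_add, smul_smul, sub_smul, one_smul]
          rw [div_mul_cancel₀ _ hk.ne']; abel
        rw [e]
        refine (map_add_le_add N _ _).trans ?_
        rw [map_smul_eq_mul, map_smul_eq_mul, Real.norm_of_nonneg (by linarith),
          Real.norm_of_nonneg (by positivity), add_mul, mul_assoc (h / k)]
        gcongr
        exact hN.le_inducedNorm_mul _ x
    change _ / h ≤ _ / k
    rw [div_le_iff₀ hh]
    calc _ ≤ (1 - h / k) + h / k * inducedNorm N (ContinuousLinearMap.id ℝ (Vec n) + k • A) - 1 := by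
          linarith
      _ = _ := by ring
  · refine ⟨-inducedNorm N A, ?_⟩
    rintro _ ⟨h, hh, rfl⟩
    have hh : 0 < h := hh
    have hpos : 0 < N v := lt_of_le_of_ne (apply_nonneg N v) fun h => hv (hN v h.symm)
    have h1 : N v ≤ N ((ContinuousLinearMap.id ℝ (Vec n) + h • A) v) + h * N (A v) := by
      have := map_sub_le_add N ((ContinuousLinearMap.id ℝ (Vec n) + h • A) v) (h • A v)
      rw [map_smul_eq_mul, Real.norm_of_nonneg hh.le] at this
      simpa using this
    have h2 := hN.le_inducedNorm_mul (ContinuousLinearMap.id ℝ (Vec n) + h • A) v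
    have h3 := hN.le_inducedNorm_mul A v
    change _ ≤ _ / h
    rw [le_div_iff₀ hh]
    have : 1 * N v ≤ (inducedNorm N (ContinuousLinearMap.id ℝ (Vec n) + h • A) +
        h * inducedNorm N A) * N v := by nlinarith
    have := le_of_mul_le_mul_right this hpos
    linarith

/-- Along a solution of `W' = A W`, the logarithmic derivative of `N W` is at most the matrix
measure of `A`. -/
lemma IsVectorNorm.deriv_le_of_matrixMeasure_le {A : Vec n →L[ℝ] Vec n} {W : ℝ → Vec n}
    {d t c : ℝ} (hA : matrixMeasure N A ≤ c) (hW : HasDerivAt W (A (W t)) t)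
    (hd : HasDerivAt (fun s => N (W s)) d t) : d ≤ c * N (W t) := by
  obtain ⟨M, hM⟩ := N.exists_lipschitzWith
  have h1 := hW.tendsto_seminorm_slope hM hd
  by_cases hv : W t = 0
  · refine le_of_tendsto h1 (Eventually.of_forall fun h => ?_)
    simp [hv]
  · have h2 := (hN.tendsto_matrixMeasure hv A).mul_const (N (W t))
    refine (le_of_tendsto_of_tendsto h1 h2 ?_).trans (by gcongr)
    filter_upwards [self_mem_nhdsWithin] with h hh
    have hh : 0 < h := hh
    have h3 := hN.le_inducedNorm_mul (ContinuousLinearMap.id ℝ (Vec n) + h • A) (W t)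
    simp only [add_apply, ContinuousLinearMap.id_apply,
            smul_apply] at h3
    rw [div_mul_eq_mul_div]
    gcongr
    linarith

end MatrixMeasure

/-! ### Continuous selections of finitely many modes along a curve -/

/-- By the pigeonhole principle, some member of a finite closed cover of the line contains `r` and
accumulates at `r` from the right. -/
lemma exists_frequently_mem_of_iUnion_eq_univ {ι : Type*} [Finite ι] {A : ι → Set ℝ}
    (hA : ∀ i, IsClosed (A i)) (hcov : ⋃ i, A i = univ) (r : ℝ) :
    ∃ i, r ∈ A i ∧ ∃ᶠ q in 𝓝[>] r, q ∈ A i := by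
  obtain ⟨i, hi⟩ : ∃ i, ∃ᶠ q in 𝓝[>] r, q ∈ A i := by
    by_contra! h
    obtain ⟨q, hq⟩ := (eventually_all.2 h).exists
    obtain ⟨i, hi⟩ := mem_iUnion.1 (hcov ▸ mem_univ q : q ∈ ⋃ i, A i)
    exact hq i hi
  refine ⟨i, ?_, hi⟩
  have : r ∈ closure (A i) := mem_closure_iff_frequently.2 (hi.filter_mono nhdsWithin_le_nhds)
  rwa [(hA i).closure_eq] at this

/-- A continuous function on the line that is Lipschitz at small scales on each member of a finite
closed cover is globally Lipschitz with the same constant. -/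
lemma LipschitzWith.of_finite_closed_cover {ι E : Type*} [Finite ι] [NormedAddCommGroup E]
    {g : ℝ → E} (hg : Continuous g) {A : ι → Set ℝ} (hA : ∀ i, IsClosed (A i))
    (hcov : ⋃ i, A i = univ) {M : NNReal} {η : ℝ} (hη : 0 < η)
    (h : ∀ i, ∀ q ∈ A i, ∀ q' ∈ A i, |q - q'| < η → ‖g q - g q'‖ ≤ M * |q - q'|) :
    LipschitzWith M g := by
  have key : ∀ a b, a ≤ b → ‖g b - g a‖ ≤ M * (b - a) := by
    intro a b hab
    -- Continuous induction: at each `q`, step to a nearby point of a member containing `q`.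
    have hsub : Icc a b ⊆ {q | ‖g q - g a‖ ≤ M * (q - a)} := by
      refine IsClosed.Icc_subset_of_forall_exists_gt ?_ (by simp) ?_
      · exact (isClosed_le (by fun_prop) (by fun_prop)).inter isClosed_Icc
      · rintro q ⟨hq, -⟩ y hy
        obtain ⟨i, hqi, hi⟩ := exists_frequently_mem_of_iUnion_eq_univ hA hcov q
        have hy : q < y := hy
        obtain ⟨z, hzi, hz⟩ := (hi.and_eventually
          (Ioc_mem_nhdsGT (lt_min hy (show q < q + η / 2 by linarith)))).exists
        have hz1 := hz.1
        have hz2 : z ≤ y := hz.2.trans (min_le_left _ _)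
        have hz3 : z ≤ q + η / 2 := hz.2.trans (min_le_right _ _)
        refine ⟨z, ?_, hz1, hz2⟩
        have h1 := h i z hzi q hqi (by rw [abs_of_pos (by linarith)]; linarith)
        rw [abs_of_pos (by linarith)] at h1
        have hq : ‖g q - g a‖ ≤ M * (q - a) := hq
        calc ‖g z - g a‖ = ‖(g z - g q) + (g q - g a)‖ := by abel_nf
          _ ≤ ‖g z - g q‖ + ‖g q - g a‖ := norm_add_le _ _
          _ ≤ M * (z - q) + M * (q - a) := by gcongr
          _ = M * (z - a) := by ring
    exact hsub (right_mem_Icc.2 hab)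
  refine LipschitzWith.of_dist_le_mul fun x y => ?_
  rw [dist_eq_norm, Real.dist_eq]
  rcases le_total x y with hxy | hxy
  · rw [norm_sub_rev, abs_sub_comm, abs_of_nonneg (by linarith)]
    exact key x y hxy
  · rw [abs_of_nonneg (by linarith)]
    exact key y x hxy

/-! ### Contraction of a Lipschitz family of curves -/

/-- Let the curves `Ψ t` evolve with velocity `G t`. If wherever both have a derivative with respect
to the curve parameter that of `G t` is obtained from that of `Ψ t` by a matrix of measure
at most `-c`, then the distance of the end points decays at rate `c`.

By Rademacher's and Fubini's theorems, for almost every parameter `r` the curves `G t` are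
differentiable at `r` for almost all `t`. For such `r` the tangent vector `W t` of `Ψ t` at `r`
exists at all times and is absolutely continuous in `t`, with `W' = A W` almost everywhere. -/
lemma IsVectorNorm.map_sub_le_of_contracting_family {n : ℕ} {N : Seminorm ℝ (Vec n)}
    (hN : IsVectorNorm N) {Ψ G : ℝ → ℝ → Vec n} {t₀ t₁ c B : ℝ} {L M : NNReal}
    (hG : Continuous G.uncurry) (hGL : ∀ t, LipschitzWith M (G t))
    (hΨL : ∀ t, LipschitzWith L (Ψ t))
    (hΨ : ∀ t ∈ Icc t₀ t₁, ∀ r, Ψ t r = Ψ t₀ r + ∫ s in t₀..t, G s r)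
    (hder : ∀ t ∈ Icc t₀ t₁, ∀ r w u, HasDerivAt (Ψ t) w r → HasDerivAt (G t) u r →
      ∃ A : Vec n →L[ℝ] Vec n, u = A w ∧ matrixMeasure N A ≤ -c)
    (h0 : ∀ r ∈ Ioo (0 : ℝ) 1, N (deriv (Ψ t₀) r) ≤ B) {t : ℝ} (ht : t ∈ Icc t₀ t₁) :
    N (Ψ t 1 - Ψ t 0) ≤ Real.exp (-c * (t - t₀)) * B := by
  obtain ⟨MN, hMN⟩ := N.exists_lipschitzWith
  refine N.map_sub_le_of_ae_deriv_le (hΨL t) ?_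
  have hmeas : MeasurableSet {p : ℝ × ℝ | DifferentiableAt ℝ (G p.1) p.2} :=
    measurableSet_of_differentiableAt_with_param ℝ hG
  -- Rademacher's theorem at each time, then an exchange of the quantifiers by Fubini's theorem.
  have hae : ∀ᵐ r : ℝ, ∀ᵐ s : ℝ, DifferentiableAt ℝ (G s) r :=
    (Measure.ae_ae_comm hmeas).1 (Eventually.of_forall fun s => (hGL s).ae_differentiableAt_real)
  filter_upwards [hae, (hΨL t₀).ae_differentiableAt_real] with r hr hr0 hr1
  set u : ℝ → Vec n := fun s => deriv (G s) r with hu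
  have hum : Measurable u := (measurable_deriv_with_param hG).comp measurable_prodMk_right
  have hub : ∀ s, ‖u s‖ ≤ M := fun s => norm_deriv_le_of_lipschitz (hGL s)
  have hui : ∀ a b, IntervalIntegrable u volume a b := fun a b =>
    (intervalIntegrable_const (c := (M : ℝ))).mono_fun hum.aestronglyMeasurable
      (Eventually.of_forall fun s => (hub s).trans (le_abs_self _))
  set W : ℝ → Vec n := fun τ => deriv (Ψ t₀) r + ∫ s in t₀..τ, u s with hW
  have hWder : ∀ τ ∈ Icc t₀ t₁, HasDerivAt (Ψ τ) (W τ) r := by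
    intro τ hτ
    have h1 := intervalIntegral.hasDerivAt_integral_of_dominated_loc_of_lip (μ := volume)
      (F := fun r s => G s r) (F' := u) (x₀ := r) (s := univ) (a := t₀) (b := τ)
      (bound := fun _ => (M : ℝ)) univ_mem
      (Eventually.of_forall fun q =>
        (hG.comp (by fun_prop : Continuous fun s => (s, q))).aestronglyMeasurable)
      ((hG.comp (by fun_prop : Continuous fun s => (s, r))).intervalIntegrable _ _)
      hum.aestronglyMeasurable
      (Eventually.of_forall fun s _ => by
        rw [Real.nnabs_coe]; exact (hGL s).lipschitzOnWith)
      intervalIntegrable_const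
      (by filter_upwards [hr] with s hs _ using hs.hasDerivAt)
    have h2 := hr0.hasDerivAt.add h1.2
    refine h2.congr_of_eventuallyEq (Eventually.of_forall fun q => ?_)
    exact hΨ τ hτ q
  have hNW : AbsolutelyContinuousOnInterval (fun τ => N (W τ)) t₀ t := by
    refine hMN.lipschitzOnWith (s := univ) |>.comp_absolutelyContinuousOnInterval ?_
      (mapsTo_univ _ _)
    have hc : AbsolutelyContinuousOnInterval (fun _ : ℝ => deriv (Ψ t₀) r) t₀ t :=
      ((LipschitzWith.const (deriv (Ψ t₀) r)).lipschitzOnWith).absolutelyContinuousOnInterval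
    exact hc.fun_add
      (lipschitzOnWith_intervalIntegral ht.1 (hui _ _) fun s _ =>
        hub s).absolutelyContinuousOnInterval
  have key := hNW.le_exp_integral_mul ht.1 (l := fun _ => -c) (by simp) (by
    filter_upwards [hr, (hui t₀ t).ae_hasDerivAt_integral, hNW.ae_differentiableAt]
      with τ h1 h2 h3 hτ
    have hτ1 : τ ∈ Icc t₀ t₁ := ⟨hτ.1.le, hτ.2.le.trans ht.2⟩
    have hτ2 : τ ∈ uIcc t₀ t := by rw [uIcc_of_le ht.1]; exact Ioo_subset_Icc_self hτ
    obtain ⟨A, hA, hμ⟩ := hder τ hτ1 r _ _ (hWder τ hτ1) h1.hasDerivAt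
    have h4 : HasDerivAt W (A (W τ)) τ := by
      rw [← hA]; exact (h2 hτ2 t₀ left_mem_uIcc).const_add _
    exact hN.deriv_le_of_matrixMeasure_le hμ h4 (h3 hτ2).hasDerivAt)
  rw [(hWder t ht).deriv]
  refine key.trans ?_
  have e1 : W t₀ = deriv (Ψ t₀) r := by simp [hW]
  have e2 : ∫ _ in t₀..t, -c = -c * (t - t₀) := by
    rw [intervalIntegral.integral_const, smul_eq_mul, mul_comm]
  rw [e1, e2]
  gcongr
  exact h0 r hr1

/-! ### Solutions of piecewise smooth continuous systems -/

section Solutions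

variable {n p : ℕ} {N : Seminorm ℝ (Vec n)} {S : Fin p → Set (Vec n)}
  {F : Fin p → Vec n → ℝ → Vec n} {f : Vec n → ℝ → Vec n} {D C : Set (Vec n)} {t₀ t₁ : ℝ}

/-- The one-sided Lipschitz condition makes solutions depend Lipschitz continuously on their initial
values, and in particular makes them unique. -/
lemma CaratheodoryConditions.exists_norm_sub_le (hcar : CaratheodoryConditions N f D t₀)
    (h01 : t₀ ≤ t₁) : ∃ M : NNReal, ∀ x y : ℝ → Vec n, IsCaratheodorySolution f D t₀ t₁ x →
      IsCaratheodorySolution f D t₀ t₁ y → ∀ t ∈ Icc t₀ t₁, ‖x t - y t‖ ≤ M * ‖x t₀ - y t₀‖ := by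
  obtain ⟨l, hl, hfl⟩ := hcar.one_sided_lipschitz
  have hli : IntervalIntegrable l volume t₀ t₁ :=
    (intervalIntegrable_iff_integrableOn_Icc_of_le h01).2 (hl t₁ h01)
  refine ⟨(Real.exp (∫ s in t₀..t₁, |l s|)).toNNReal, fun x y hx hy t ht => ?_⟩
  rw [Real.coe_toNNReal _ (Real.exp_pos _).le]
  have hsub : uIcc t₀ t ⊆ uIcc t₀ t₁ := by
    rw [uIcc_of_le ht.1, uIcc_of_le h01]; exact Icc_subset_Icc_right ht.2
  have hz : AbsolutelyContinuousOnInterval (fun s => x s - y s) t₀ t :=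
    (hx.absolutelyContinuous.fun_sub hy.absolutelyContinuous).mono hsub
  have hn : AbsolutelyContinuousOnInterval (fun s => ‖x s - y s‖) t₀ t :=
    (lipschitzWith_one_norm.lipschitzOnWith (s := univ)).comp_absolutelyContinuousOnInterval hz
      (mapsTo_univ _ _)
  have hlt : IntervalIntegrable l volume t₀ t := hli.mono_set hsub
  have key := (hn.fun_mul hn).le_exp_integral_mul ht.1 (hlt.const_mul 2) (by
    have hxo := (ae_restrict_iff' measurableSet_Icc).1 hx.ode
    have hyo := (ae_restrict_iff' measurableSet_Icc).1 hy.ode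
    filter_upwards [hxo, hyo] with s h1 h2 hs
    have hs' : s ∈ Icc t₀ t₁ := ⟨hs.1.le, hs.2.le.trans ht.2⟩
    have hd := ((h1 hs').sub (h2 hs')).norm_sq
    have e : (fun s => ‖x s - y s‖ * ‖x s - y s‖) = fun s => ‖(x - y) s‖ ^ 2 := by
      funext s; rw [Pi.sub_apply, sq]
    rw [e, hd.deriv]
    have h3 := hfl s hs'.1 _ (hx.mem s hs') _ (hy.mem s hs')
    rw [real_inner_self_eq_norm_sq] at h3
    simp only [Pi.sub_apply]
    nlinarith)
  rw [intervalIntegral.integral_const_mul] at key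
  have hle : ∫ s in t₀..t, l s ≤ ∫ s in t₀..t₁, |l s| :=
    (intervalIntegral.integral_mono_on ht.1 hlt hlt.abs fun s _ => le_abs_self _).trans
      (intervalIntegral.integral_mono_interval le_rfl ht.1 ht.2
        (Eventually.of_forall fun s => abs_nonneg _) hli.abs)
  refine le_of_sq_le_sq ?_ (by positivity)
  calc ‖x t - y t‖ ^ 2 ≤ Real.exp (2 * ∫ s in t₀..t, l s) * ‖x t₀ - y t₀‖ ^ 2 := by
        rw [sq, sq]; exact key
    _ ≤ Real.exp (2 * ∫ s in t₀..t₁, |l s|) * ‖x t₀ - y t₀‖ ^ 2 := by gcongr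
    _ = _ := by rw [mul_pow, ← Real.exp_nat_mul]; norm_num

lemma IsPWSC.closure_subset (h : IsPWSC S F f D t₀) (i : Fin p) : closure (S i) ⊆ D := by
  rw [h.domain]; exact subset_iUnion (fun i => closure (S i)) i

lemma IsPWSC.eq_mode_closure (h : IsPWSC S F f D t₀) (i : Fin p) {x : Vec n}
    (hx : x ∈ closure (S i)) {t : ℝ} (ht : t₀ ≤ t) : f x t = F i x t := by
  obtain ⟨U, -, hSU, hFc, -, -⟩ := h.mode_smooth i
  have hf : ContinuousOn (fun x => f x t) (closure (S i)) :=
    h.continuous.comp (f := fun x => (x, t)) (by fun_prop) fun x hx =>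
      ⟨h.closure_subset i hx, ht⟩
  have hF : ContinuousOn (fun x => F i x t) (closure (S i)) :=
    hFc.comp (f := fun x => (x, t)) (by fun_prop) fun x hx => ⟨hSU hx, ht⟩
  exact Set.EqOn.of_subset_closure (s := S i) (fun x hx => h.eq_mode i x hx t ht) hf hF
    subset_closure Subset.rfl hx

/-- On a compact set, each mode is Lipschitz in the state at small scales, uniformly in time. Only
small scales are available because segments have to stay in the domain of the mode. -/
lemma IsPWSC.exists_mode_lipschitz (h : IsPWSC S F f D t₀) {Γ : Set (Vec n)} (hΓ : IsCompact Γ)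
    (t₁ : ℝ) (i : Fin p) : ∃ (M : NNReal) (ρ : ℝ), 0 < ρ ∧ ∀ t ∈ Icc t₀ t₁,
      ∀ a ∈ Γ ∩ closure (S i), ∀ b ∈ Γ ∩ closure (S i), dist a b < ρ →
        ‖F i a t - F i b t‖ ≤ M * ‖a - b‖ := by
  obtain ⟨U, hU, hSU, -, hdiff, hDc⟩ := h.mode_smooth i
  have hcpt : IsCompact (Γ ∩ closure (S i)) := hΓ.inter_right isClosed_closure
  obtain ⟨ρ, hρ, hsub⟩ := hcpt.exists_cthickening_subset_open hU (inter_subset_right.trans hSU)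
  obtain ⟨M, hM⟩ := ((hcpt.cthickening (r := ρ)).prod
    (isCompact_Icc (a := t₀) (b := t₁))).exists_bound_of_continuousOn
      (hDc.mono (prod_mono hsub Icc_subset_Ici_self))
  refine ⟨M.toNNReal, ρ, hρ, fun t ht a ha b hb hab => ?_⟩
  have hball : Metric.closedBall b ρ ⊆ Metric.cthickening ρ (Γ ∩ closure (S i)) :=
    Metric.closedBall_subset_cthickening hb ρ
  refine (convex_closedBall b ρ).norm_image_sub_le_of_norm_fderiv_le (𝕜 := ℝ)
    (f := fun x => F i x t) (fun x hx => ?_) (fun x hx => ?_)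
    (Metric.mem_closedBall_self hρ.le) (Metric.mem_closedBall.2 hab.le)
  · exact (hdiff t ht.1).differentiableAt (hU.mem_nhds (hsub (hball hx)))
  · exact (hM (x, t) ⟨hball hx, ht⟩).trans (Real.le_coe_toNNReal M)

lemma IsPWSC.exists_modes_lipschitz (h : IsPWSC S F f D t₀) {Γ : Set (Vec n)} (hΓ : IsCompact Γ)
    (t₁ : ℝ) : ∃ (M : NNReal) (ρ : ℝ), 0 < ρ ∧ ∀ i, ∀ t ∈ Icc t₀ t₁,
      ∀ a ∈ Γ ∩ closure (S i), ∀ b ∈ Γ ∩ closure (S i), dist a b < ρ →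
        ‖F i a t - F i b t‖ ≤ M * ‖a - b‖ := by
  choose M ρ hρ hM using h.exists_mode_lipschitz hΓ t₁
  have hsup : ∃ M₀, ∀ i, M i ≤ M₀ := ⟨∑ i, M i, fun i =>
    Finset.single_le_sum (fun _ _ => zero_le) (Finset.mem_univ i)⟩
  obtain ⟨M₀, hM₀⟩ := hsup
  obtain ⟨ρ₀, hρ₀, hle⟩ : ∃ ρ₀ : ℝ, 0 < ρ₀ ∧ ∀ i, ρ₀ ≤ ρ i := by
    have h1 : ∀ᶠ r in 𝓝[>] (0 : ℝ), ∀ i, r ≤ ρ i := eventually_all.2 fun i =>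
      nhdsWithin_le_nhds ((eventually_lt_nhds (hρ i)).mono fun _ h => h.le)
    obtain ⟨r, hr, hr0⟩ := (h1.and self_mem_nhdsWithin).exists
    exact ⟨r, hr0, hr⟩
  refine ⟨M₀, ρ₀, hρ₀, fun i t ht a ha b hb hab => ?_⟩
  refine (hM i t ht a ha b hb (hab.trans_le (hle i))).trans ?_
  gcongr
  exact hM₀ i

/-- The regions that a curve in `D` passes through form a finite closed cover of its parameters. -/
lemma IsPWSC.cover_preimage (h : IsPWSC S F f D t₀) {q : ℝ → Vec n} (hqD : ∀ r, q r ∈ D) :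
    ⋃ i, q ⁻¹' closure (S i) = univ := by
  rw [← preimage_iUnion, ← h.domain]
  exact eq_univ_of_forall hqD

/-- Chain rule along a curve in `D`: although `f` has no derivative at the interfaces, every
derivative of `f` along the curve is given by the Jacobian of one of the modes. -/
lemma IsPWSC.exists_fderiv_mode_eq (h : IsPWSC S F f D t₀) {q : ℝ → Vec n} (hq : Continuous q)
    (hqD : ∀ r, q r ∈ D) {t r : ℝ} (ht : t₀ ≤ t) {w u : Vec n} (hw : HasDerivAt q w r)
    (hu : HasDerivAt (fun r => f (q r) t) u r) :
    ∃ i, q r ∈ closure (S i) ∧ u = fderiv ℝ (fun z => F i z t) (q r) w := by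
  obtain ⟨i, hri, hi⟩ := exists_frequently_mem_of_iUnion_eq_univ
    (fun i => isClosed_closure.preimage hq) (h.cover_preimage hqD) r
  obtain ⟨U, hU, hSU, -, hdiff, -⟩ := h.mode_smooth i
  refine ⟨i, hri, ?_⟩
  have hF : HasDerivAt (fun r => F i (q r) t) (fderiv ℝ (fun z => F i z t) (q r) w) r :=
    ((hdiff t ht).differentiableAt (hU.mem_nhds (hSU hri))).hasFDerivAt.comp_hasDerivAt r hw
  have hF' : HasDerivWithinAt (fun r => f (q r) t) (fderiv ℝ (fun z => F i z t) (q r) w)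
      (q ⁻¹' closure (S i)) r :=
    hF.hasDerivWithinAt.congr (fun s hs => h.eq_mode_closure i hs ht)
      (h.eq_mode_closure i hri ht)
  have hacc : AccPt r (𝓟 (q ⁻¹' closure (S i))) := by
    rw [accPt_iff_frequently_nhdsNE]
    exact hi.filter_mono (nhdsWithin_mono _ fun x hx => (ne_of_gt hx : x ≠ r))
  exact hacc.uniqueDiffWithinAt.eq_deriv _ hu.hasDerivWithinAt hF'

lemma IsCaratheodorySolution.continuousOn {x : ℝ → Vec n} (hx : IsCaratheodorySolution f D t₀ t₁ x)
    (h01 : t₀ ≤ t₁) : ContinuousOn x (Icc t₀ t₁) := by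
  have := hx.absolutelyContinuous.continuousOn
  rwa [uIcc_of_le h01] at this

lemma IsPWSC.solution_eq_add_integral (h : IsPWSC S F f D t₀) {x : ℝ → Vec n}
    (hx : IsCaratheodorySolution f D t₀ t₁ x) {t : ℝ} (ht : t ∈ Icc t₀ t₁) :
    x t = x t₀ + ∫ s in t₀..t, f (x s) s := by
  have h01 : t₀ ≤ t₁ := ht.1.trans ht.2
  refine hx.absolutelyContinuous.eq_add_integral_of_ae_hasDerivAt h01 ?_
    ((ae_restrict_iff' measurableSet_Icc).1 hx.ode) ht
  exact h.continuous.comp ((hx.continuousOn h01).prodMk continuousOn_id) fun s hs =>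
    ⟨hx.mem s hs, hs.1⟩

/-- The contraction estimate on a bounded time interval. The curve joining the initial values is
transported by the flow; `map_sub_le_of_contracting_family` applies to the transported curves. -/
lemma IsPWSC.contraction_estimate (hN : IsVectorNorm N) {K c : ℝ} (h : IsPWSC S F f D t₀)
    (hcar : CaratheodoryConditions N f D t₀) (hC : IsKReachable N K C)
    (hμ : ∀ i, ∀ x ∈ closure (S i), ∀ t, t₀ ≤ t →
      matrixMeasure N (fderiv ℝ (fun z => F i z t) x) ≤ -c)
    (hflow : FlowDefined f D C t₀ t₁) {x y : ℝ → Vec n}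
    (hx : IsCaratheodorySolution f D t₀ t₁ x) (hy : IsCaratheodorySolution f D t₀ t₁ y)
    (hxC : x t₀ ∈ C) (hyC : y t₀ ∈ C) {t : ℝ} (ht : t ∈ Icc t₀ t₁) :
    N (x t - y t) ≤ K * Real.exp (-c * (t - t₀)) * N (x t₀ - y t₀) := by
  have h01 : t₀ ≤ t₁ := ht.1.trans ht.2
  obtain ⟨γ, hγ, hγC, hγ0, hγ1, hγK⟩ := hC.2 _ hxC _ hyC
  obtain ⟨Λ, hΛ⟩ := hcar.exists_norm_sub_le h01
  obtain ⟨L₀, hL₀⟩ := hγ.exists_lipschitzOnWith (by decide) (convex_Icc _ _) isCompact_Icc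
  choose z hz hz0 using fun r : Icc (0 : ℝ) 1 => hflow (γ r) (hγC r r.2)
  -- Times and curve parameters are clamped to their intervals, so that all functions are total.
  set Ψ : ℝ → ℝ → Vec n := fun t r => z (projIcc 0 1 zero_le_one r) (projIcc t₀ t₁ h01 t) with hΨ
  set G : ℝ → ℝ → Vec n := fun t r => f (Ψ t r) (projIcc t₀ t₁ h01 t) with hG
  have hΨD : ∀ t r, Ψ t r ∈ D := fun t r => (hz _).mem _ (projIcc t₀ t₁ h01 t).2
  have hΨL : ∀ t, LipschitzWith (Λ * L₀) (Ψ t) := by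
    intro t
    refine LipschitzWith.of_dist_le_mul fun r q => ?_
    have h1 := hΛ _ _ (hz (projIcc 0 1 zero_le_one r)) (hz (projIcc 0 1 zero_le_one q)) _
      (projIcc t₀ t₁ h01 t).2
    rw [hz0, hz0, ← dist_eq_norm, ← dist_eq_norm] at h1
    have h2 := hL₀.dist_le_mul _ (projIcc (0 : ℝ) 1 zero_le_one r).2 _
      (projIcc (0 : ℝ) 1 zero_le_one q).2
    have h3 := (LipschitzWith.projIcc (zero_le_one (α := ℝ))).dist_le_mul r q
    rw [NNReal.coe_one, one_mul, Subtype.dist_eq] at h3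
    calc dist (Ψ t r) (Ψ t q) ≤ Λ * (L₀ * dist r q) :=
          h1.trans (by gcongr; exact h2.trans (by gcongr))
      _ = _ := by push_cast; ring
  have hΨc : Continuous Ψ.uncurry := by
    refine continuous_prod_of_continuous_lipschitzWith' _ (Λ * L₀) hΨL fun r => ?_
    exact ((hz (projIcc 0 1 zero_le_one r)).continuousOn h01).comp_continuous
      (continuous_subtype_val.comp continuous_projIcc) fun t => (projIcc t₀ t₁ h01 t).2
  have hGc : Continuous G.uncurry := by
    have := h.continuous.comp_continuous (f := fun p : ℝ × ℝ =>
      (Ψ.uncurry p, (projIcc t₀ t₁ h01 p.1 : ℝ)))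
      (hΨc.prodMk ((continuous_subtype_val.comp continuous_projIcc).comp continuous_fst))
      fun p => ⟨hΨD _ _, (projIcc t₀ t₁ h01 p.1).2.1⟩
    exact this
  set Γ : Set (Vec n) := Ψ.uncurry '' (Icc t₀ t₁ ×ˢ Icc 0 1) with hΓ
  have hΓc : IsCompact Γ := (isCompact_Icc.prod isCompact_Icc).image hΨc
  have hΨΓ : ∀ t r, Ψ t r ∈ Γ := fun t r =>
    ⟨(projIcc t₀ t₁ h01 t, projIcc (0 : ℝ) 1 zero_le_one r),
      ⟨(projIcc t₀ t₁ h01 t).2, (projIcc (0 : ℝ) 1 zero_le_one r).2⟩, by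
        simp [hΨ, Function.uncurry]⟩
  obtain ⟨M, ρ, hρ, hM⟩ := h.exists_modes_lipschitz hΓc t₁
  have hΨt : ∀ t, Continuous (Ψ t) := fun t => (hΨL t).continuous
  have hGL : ∀ t, LipschitzWith (M * (Λ * L₀)) (G t) := by
    intro t
    -- At this scale the images under `Ψ t` are closer than `ρ`; `+ 1` avoids dividing by zero.
    have hpos : (0 : ℝ) < (Λ * L₀ : NNReal) + 1 := by positivity
    refine LipschitzWith.of_finite_closed_cover (η := ρ / ((Λ * L₀ : NNReal) + 1))
      (hGc.comp (by fun_prop : Continuous fun r => (t, r)))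
      (fun i => isClosed_closure.preimage (hΨt t)) (h.cover_preimage (hΨD t)) (by positivity) ?_
    intro i q hq q' hq' hlt
    have h1 := (hΨL t).dist_le_mul q q'
    rw [Real.dist_eq] at h1
    have h2 : dist (Ψ t q) (Ψ t q') < ρ := by
      rw [lt_div_iff₀ hpos] at hlt
      nlinarith [abs_nonneg (q - q')]
    have h3 := hM i _ (projIcc t₀ t₁ h01 t).2 _ ⟨hΨΓ t q, hq⟩ _ ⟨hΨΓ t q', hq'⟩ h2
    have hτ := (projIcc t₀ t₁ h01 t).2.1
    change ‖f _ _ - f _ _‖ ≤ _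
    rw [h.eq_mode_closure i hq hτ, h.eq_mode_closure i hq' hτ]
    refine h3.trans ?_
    rw [← dist_eq_norm, NNReal.coe_mul, mul_assoc]
    gcongr
  have hproj : ∀ s ∈ Icc t₀ t₁, (projIcc t₀ t₁ h01 s : ℝ) = s := fun s hs => by
    rw [projIcc_of_mem h01 hs]
  have hΨint : ∀ t ∈ Icc t₀ t₁, ∀ r, Ψ t r = Ψ t₀ r + ∫ s in t₀..t, G s r := by
    intro t ht r
    have h1 := h.solution_eq_add_integral (hz (projIcc 0 1 zero_le_one r)) ht
    simp only [hG, hΨ]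
    rw [hproj t ht, hproj t₀ (left_mem_Icc.2 h01), h1]
    congr 1
    refine intervalIntegral.integral_congr fun s hs => ?_
    rw [uIcc_of_le ht.1] at hs
    rw [hproj s ⟨hs.1, hs.2.trans ht.2⟩]
  have hder : ∀ t ∈ Icc t₀ t₁, ∀ r w u, HasDerivAt (Ψ t) w r → HasDerivAt (G t) u r →
      ∃ A : Vec n →L[ℝ] Vec n, u = A w ∧ matrixMeasure N A ≤ -c := by
    intro t ht r w u hw hu
    have hu' : HasDerivAt (fun r => f (Ψ t r) t) u r := by
      have e : G t = fun r => f (Ψ t r) t := by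
        funext r; simp only [hG]; rw [hproj t ht]
      rwa [e] at hu
    obtain ⟨i, hi, hA⟩ := h.exists_fderiv_mode_eq (hΨt t) (hΨD t) ht.1 hw hu'
    exact ⟨_, hA, hμ i _ hi t ht.1⟩
  have hB : ∀ r ∈ Ioo (0 : ℝ) 1, N (deriv (Ψ t₀) r) ≤ K * N (y t₀ - x t₀) := by
    intro r hr
    have e : Ψ t₀ =ᶠ[𝓝 r] γ := by
      filter_upwards [Ioo_mem_nhds hr.1 hr.2] with q hq
      simp only [hΨ]
      rw [hproj t₀ (left_mem_Icc.2 h01), hz0, projIcc_of_mem _ (Ioo_subset_Icc_self hq)]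
    rw [e.deriv_eq, ← derivWithin_of_mem_nhds (Icc_mem_nhds hr.1 hr.2)]
    exact hγK r (Ioo_subset_Icc_self hr)
  have key := hN.map_sub_le_of_contracting_family hGc hGL hΨL hΨint hder hB ht
  -- The transported end points are the given solutions, by uniqueness.
  have huniq : ∀ r : Icc (0 : ℝ) 1, ∀ v : ℝ → Vec n, IsCaratheodorySolution f D t₀ t₁ v →
      γ r = v t₀ → z r t = v t := by
    intro r v hv hrv
    have h1 := hΛ _ _ (hz r) hv t ht
    rw [hz0, hrv, sub_self, norm_zero, mul_zero] at h1
    exact sub_eq_zero.1 (norm_le_zero_iff.1 h1)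
  have e0 : Ψ t 0 = x t := by
    simp only [hΨ]; rw [hproj t ht, projIcc_left]; exact huniq _ x hx hγ0
  have e1 : Ψ t 1 = y t := by
    simp only [hΨ]; rw [hproj t ht, projIcc_right]; exact huniq _ y hy hγ1
  rw [e0, e1, map_sub_rev N, map_sub_rev N (y t₀)] at key
  linarith

end Solutions

theorem mainTheorem1 {n p : ℕ} (N : Seminorm ℝ (Vec n)) (hN : IsVectorNorm N)
    (S : Fin p → Set (Vec n)) (F : Fin p → Vec n → ℝ → Vec n) (f : Vec n → ℝ → Vec n)
    (D C : Set (Vec n)) (t₀ K : ℝ) (c : Fin p → ℝ)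
    (hCD : C ⊆ D) (hC : IsKReachable N K C)
    (hsys : IsPWSC S F f D t₀)
    (hcar : CaratheodoryConditions N f D t₀)
    (hc : ∀ i, 0 < c i)
    (hμ : ∀ i, ∀ x ∈ closure (S i), ∀ t, t₀ ≤ t →
      matrixMeasure N (fderiv ℝ (fun z => F i z t) x) ≤ -c i) :
    (∀ t₁, t₀ ≤ t₁ → FlowDefined f D C t₀ t₁ →
      ∀ x y : ℝ → Vec n, IsCaratheodorySolution f D t₀ t₁ x → IsCaratheodorySolution f D t₀ t₁ y →
        x t₀ ∈ C → y t₀ ∈ C →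
          ∀ t ∈ Icc t₀ t₁, x t ∈ C → y t ∈ C →
            N (x t - y t) ≤ K * Real.exp (-(⨅ i, c i) * (t - t₀)) * N (x t₀ - y t₀)) ∧
    (IsForwardInvariantSet f D C t₀ →
      ∀ x y : ℝ → Vec n, (∀ t₁, t₀ ≤ t₁ → IsCaratheodorySolution f D t₀ t₁ x) →
        (∀ t₁, t₀ ≤ t₁ → IsCaratheodorySolution f D t₀ t₁ y) → x t₀ ∈ C → y t₀ ∈ C →
          (∀ t, t₀ ≤ t →
            N (x t - y t) ≤ K * Real.exp (-(⨅ i, c i) * (t - t₀)) * N (x t₀ - y t₀)) ∧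
          Tendsto (fun t => N (x t - y t)) atTop (𝓝 0)) := by
  have hμ' : ∀ i, ∀ x ∈ closure (S i), ∀ t, t₀ ≤ t →
      matrixMeasure N (fderiv ℝ (fun z => F i z t) x) ≤ -(⨅ i, c i) := fun i x hx t ht =>
    (hμ i x hx t ht).trans (neg_le_neg (ciInf_le (finite_range c).bddBelow i))
  have hpos : 0 < ⨅ i, c i := by
    -- The domain is nonempty, so there is at least one mode.
    obtain ⟨x, hx⟩ := hsys.connected.nonempty
    rw [hsys.domain] at hx
    obtain ⟨i, -⟩ := mem_iUnion.1 hx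
    have : Nonempty (Fin p) := ⟨i⟩
    obtain ⟨j, hj⟩ := exists_eq_ciInf_of_finite (f := c)
    rw [← hj]; exact hc j
  refine ⟨fun t₁ _ hflow x y hx hy hxC hyC t ht _ _ =>
    hsys.contraction_estimate hN hcar hC hμ' hflow hx hy hxC hyC ht, ?_⟩
  intro hinv x y hx hy hxC hyC
  have hest : ∀ t, t₀ ≤ t →
      N (x t - y t) ≤ K * Real.exp (-(⨅ i, c i) * (t - t₀)) * N (x t₀ - y t₀) := fun t ht =>
    hsys.contraction_estimate hN hcar hC hμ' (hinv t ht).1 (hx t ht) (hy t ht) hxC hyC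
      (right_mem_Icc.2 ht)
  refine ⟨hest, ?_⟩
  have hlim : Tendsto (fun t => K * Real.exp (-(⨅ i, c i) * (t - t₀)) * N (x t₀ - y t₀)) atTop
      (𝓝 0) := by
    have h1 : Tendsto (fun t : ℝ => -(⨅ i, c i) * (t - t₀)) atTop atBot :=
      (tendsto_atTop_add_const_right _ (-t₀) tendsto_id).const_mul_atTop_of_neg (by linarith)
    have h2 := ((Real.tendsto_exp_atBot.comp h1).const_mul K).mul_const (N (x t₀ - y t₀))
    simpa using h2
  refine squeeze_zero' (Eventually.of_forall fun t => apply_nonneg N _) ?_ hlim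
  filter_upwards [eventually_ge_atTop t₀] with t ht using hest t ht
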